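/- Let $\Bbbk$ be a field and let $\mathfrak g$ be a (right) Leibniz algebra over $\Bbbk$: a $\Bbbk$-vector space with a bilinear product satisfying $x(yz)=(xy)z-(xz)y$. Let $\mathfrak g_{\mathrm{Lie}}=\mathfrak g/\langle x^2\mid x\in\mathfrak g\rangle_{\Bbbk}$ be the associated Lie algebra, with $x\mapsto\overline x$ the canonical surjection, and let $\mathrm{Mod}^{\mathsf{Lie}}_{\mathfrak g_{\mathrm{Lie}}}$ be the category of right $\mathfrak g_{\mathrm{Lie}}$-modules. Let $\mathrm{Mod}^{\mathsf{Leib}}_{\mathfrak g}$ be the category of $\mathfrak g$-modules, i.e. vector spaces $M$ with bilinear left and right actions of $\mathfrak g$ satisfying $$m(xy)=(mx)y-(my)x,\qquad x(my)=(xm)y-(xy)m,\qquad x(ym)=(xy)m-(xm)y .$$ For a right $\mathfrak g_{\mathrm{Lie}}$-module $N$, let $N^{\mathrm s}$ (respectively $N^{\mathrm a}$) be the $\mathfrak g$-module with underlying space $N$, right action $nx=n\overline x$ and left action $xn=-n\overline x$ (respectively $xn=0$). The functors $(-)^{\mathrm s}$ and $(-)^{\mathrm a}$ are exact. Let $\mathfrak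 g^\downarrow$ be $\mathfrak g$ with the right $\mathfrak g_{\mathrm{Lie}}$-action $x\overline y=xy$. Equip $N\otimes_{\Bbbk}\mathfrak g^\downarrow$ and $\hom_{\Bbbk}(\mathfrak g^\downarrow,N)$ with the diagonal right actions $(n\otimes x)\overline y=n\overline y\otimes x+n\otimes xy$ and $(f\overline y)(x)=f(x)\overline y-f(xy)$. Let * $\mathrm{lext}(N)$ be the $\mathfrak g$-module $(N\otimes\mathfrak g^\downarrow)\oplus N$ with $[t,n]\,y=[t\overline y,n\overline y]$ and $z\,[t,n]=[n\otimes z,-n\overline z]$, with canonical surjection $\mathrm{lext}(N)\twoheadrightarrow N^{\mathrm s}$, $[t,n]\mapsto n$; * $\mathrm{rext}(N)$ be the $\mathfrak g$-module $N\oplus\hom_{\Bbbk}(\mathfrak g^\downarrow,N)$ with $[n,f]\,y=[n\overline y,f\overline y]$ and $z\,[n,f]=[f(z),-f\overline z]$, with canonical inclusion $N^{\mathrm a}\hookrightarrow\mathrm{rext}(N)$, $n\mapsto[n,0]$. Let $N_1,N_2$ be right $\mathfrak g_{\mathrm{Lie}}$-modules. Then, in every degree $n\ge 0$: 1. the composite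 $$\mathrm{Ext}^n_{\mathrm{Mod}^{\mathsf{Lie}}_{\mathfrak g_{\mathrm{Lie}}}}(N_1,N_2)\to\mathrm{Ext}^n_{\mathrm{Mod}^{\mathsf{Leib}}_{\mathfrak g}}(N_1^{\mathrm s},N_2^{\mathrm s})\to\mathrm{Ext}^n_{\mathrm{Mod}^{\mathsf{Leib}}_{\mathfrak g}}(\mathrm{lext}(N_1),N_2^{\mathrm s})$$ is an isomorphism of $\Bbbk$-vector spaces, where the first map is induced by the exact functor $(-)^{\mathrm s}$ and the second by the canonical surjection $\mathrm{lext}(N_1)\twoheadrightarrow N_1^{\mathrm s}$; 2. the composite $$\mathrm{Ext}^n_{\mathrm{Mod}^{\mathsf{Lie}}_{\mathfrak g_{\mathrm{Lie}}}}(N_1,N_2)\to\mathrm{Ext}^n_{\mathrm{Mod}^{\mathsf{Leib}}_{\mathfrak g}}(N_1^{\mathrm a},N_2^{\mathrm a})\to\mathrm{Ext}^n_{\mathrm{Mod}^{\mathsf{Leib}}_{\mathfrak g}}(N_1^{\mathrm a},\mathrm{rext}(N_2))$$ is an isomorphism of $\Bbbk$-vector spaces, where the first map is induced by the exact functor $(-)^{\mathrm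 a}$ and the second by the canonical inclusion $N_2^{\mathrm a}\hookrightarrow\mathrm{rext}(N_2)$. -/

import Mathlib

set_option linter.unusedSectionVars false

open CategoryTheory CategoryTheory.Limits TensorProduct

universe u

namespace LeibnizExt

noncomputable section

/-! ### Right Leibniz algebras and the associated Lie algebra -/

/-- The (right) Leibniz relation `x(yz) = (xy)z - (xz)y`.  A Leibniz algebra over the field `k` is
a `k`-vector space `g` with a `k`-bilinear product (given by the instances
`NonUnitalNonAssocRing g`, `Module k g`, `IsScalarTower k g g`, `SMulCommClass k g g`)
that satisfies it. -/
class IsLeibniz (g : Type u) [NonUnitalNonAssocRing g] : Prop where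
  leibniz : ∀ x y z : g, x * (y * z) = (x * y) * z - (x * z) * y

section LieQuotient

variable (k g : Type u) [Field k] [NonUnitalNonAssocRing g] [Module k g]
  [IsScalarTower k g g] [SMulCommClass k g g]

/-- The subspace `⟨x² | x ∈ g⟩` spanned by the squares. -/
def squares : Submodule k g := Submodule.span k (Set.range fun x : g => x * x)

/-- The quotient `g_Lie = g / ⟨x² | x ∈ g⟩`. -/
def LieQuot : Type u := g ⧸ squares k g

instance : AddCommGroup (LieQuot k g) := inferInstanceAs (AddCommGroup (g ⧸ squares k g))

instance : Module k (LieQuot k g) := inferInstanceAs (Module k (g ⧸ squares k g))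

/-- The canonical surjection `g → g_Lie`, `x ↦ x̄`. -/
def toLie : g →ₗ[k] LieQuot k g := (squares k g).mkQ

theorem toLie_surjective : Function.Surjective (toLie k g) := (squares k g).mkQ_surjective

theorem toLie_sq (x : g) : toLie k g (x * x) = 0 :=
  (Submodule.Quotient.mk_eq_zero _).2 (Submodule.subset_span ⟨x, rfl⟩)

theorem toLie_mul_comm (x y : g) : toLie k g (x * y) = - toLie k g (y * x) := by
  have h := toLie_sq k g (x + y)
  have e : (x + y) * (x + y) = x * x + x * y + (y * x + y * y) := by
    rw [add_mul, mul_add, mul_add]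
  rw [e, map_add, map_add, map_add, toLie_sq, toLie_sq, zero_add, add_zero] at h
  exact eq_neg_of_add_eq_zero_left h

variable [IsLeibniz g]

/-- The right multiplication action of `g_Lie` on `g`: `adj x ȳ = x y`. -/
def adj : g →ₗ[k] LieQuot k g →ₗ[k] g :=
  LinearMap.flip <| (squares k g).liftQ (LinearMap.mul k g).flip <| by
    rw [squares, Submodule.span_le]
    rintro _ ⟨y, rfl⟩
    ext x
    simp [IsLeibniz.leibniz x y y]

@[simp]
theorem adj_toLie (x y : g) : adj k g x (toLie k g y) = x * y := rfl

/-- The bracket of `g_Lie`, as a bilinear map: `[x̄, ȳ]` is the class of `x y`. -/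
def lieMul : LieQuot k g →ₗ[k] LieQuot k g →ₗ[k] LieQuot k g :=
  (squares k g).liftQ ((adj k g).compr₂ (toLie k g)) <| by
    rw [squares, Submodule.span_le]
    rintro _ ⟨y, rfl⟩
    ext z
    obtain ⟨z, rfl⟩ := toLie_surjective k g z
    change toLie k g ((y * y) * z) = 0
    have h : (y * y) * z = y * (y * z) + (y * z) * y := by
      rw [IsLeibniz.leibniz]; abel
    rw [h, map_add, toLie_mul_comm k g y (y * z), neg_add_cancel]

instance : Bracket (LieQuot k g) (LieQuot k g) := ⟨fun a b => lieMul k g a b⟩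

@[simp]
theorem toLie_bracket (x y : g) : ⁅toLie k g x, toLie k g y⁆ = toLie k g (x * y) := rfl

instance : LieRing (LieQuot k g) where
  add_lie a b c := by change lieMul k g _ _ = lieMul k g _ _ + lieMul k g _ _; simp
  lie_add a b c := by change lieMul k g _ _ = lieMul k g _ _ + lieMul k g _ _; simp
  lie_self a := by
    obtain ⟨x, rfl⟩ := toLie_surjective k g a
    exact toLie_sq k g x
  leibniz_lie a b c := by
    obtain ⟨x, rfl⟩ := toLie_surjective k g a
    obtain ⟨y, rfl⟩ := toLie_surjective k g b
    obtain ⟨z, rfl⟩ := toLie_surjective k g c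
    simp only [toLie_bracket]
    rw [IsLeibniz.leibniz x y z, map_sub, sub_eq_add_neg, toLie_mul_comm k g (x * z) y, neg_neg]

instance : LieAlgebra k (LieQuot k g) where
  lie_smul t a b := (lieMul k g a).map_smul t b

end LieQuotient

/-! ### The category of right modules over a Lie algebra -/

/-- A right module over a Lie algebra `h`: a vector space `M` with a bilinear action
`M × h → M` such that `m[x,y] = (mx)y - (my)x`. -/
structure LieMod (k h : Type u) [Field k] [LieRing h] [LieAlgebra k h] where
  carrier : Type u
  [addCommGroup : AddCommGroup carrier]
  [module : Module k carrier]
  act : carrier →ₗ[k] h →ₗ[k] carrier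
  act_lie : ∀ m x y, act m ⁅x, y⁆ = act (act m x) y - act (act m y) x

/-- A module over a Leibniz algebra `g`: a vector space `M` with bilinear actions
`ract : M × g → M`, `(m, x) ↦ mx`, and `lact : g × M → M`, `(x, m) ↦ xm`, that satisfy the
relations (MLL), (LML) and (LLM). -/
structure LeibMod (k g : Type u) [Field k] [NonUnitalNonAssocRing g] [Module k g] where
  carrier : Type u
  [addCommGroup : AddCommGroup carrier]
  [module : Module k carrier]
  ract : carrier →ₗ[k] g →ₗ[k] carrier
  lact : g →ₗ[k] carrier →ₗ[k] carrier
  mll : ∀ m x y, ract m (x * y) = ract (ract m x) y - ract (ract m y) x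
  lml : ∀ x m y, lact x (ract m y) = ract (lact x m) y - lact (x * y) m
  llm : ∀ x y m, lact x (lact y m) = lact (x * y) m - ract (lact x m) y

attribute [instance] LieMod.addCommGroup LieMod.module LeibMod.addCommGroup LeibMod.module

/-! ### Modules over a presented algebra

Auxiliary material for the proof that the categories of modules below are abelian: they are
equivalent to categories of modules over an associative algebra given by generators and relations
(the opposites of the enveloping algebras). -/

section Presented

variable {k X : Type u} [Field k] [AddCommGroup X] [Module k X]
  {r : TensorAlgebra k X → TensorAlgebra k X → Prop}

/-- The generator of the presented algebra `T(X)/(r)` attached to `x : X`. -/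
def gen (r : TensorAlgebra k X → TensorAlgebra k X → Prop) : X →ₗ[k] RingQuot r :=
  (RingQuot.mkAlgHom k r).toLinearMap ∘ₗ TensorAlgebra.ι k

theorem gen_induction {P : RingQuot r → Prop} (hk : ∀ c : k, P (algebraMap k _ c))
    (hX : ∀ x, P (gen r x)) (hm : ∀ a b, P a → P b → P (a * b))
    (ha : ∀ a b, P a → P b → P (a + b)) (a : RingQuot r) : P a := by
  obtain ⟨t, rfl⟩ := RingQuot.mkAlgHom_surjective k r a
  induction t using TensorAlgebra.induction with
  | algebraMap c => rw [AlgHom.commutes]; exact hk c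
  | ι x => exact hX x
  | mul a b h h' => rw [map_mul]; exact hm _ _ h h'
  | add a b h h' => rw [map_add]; exact ha _ _ h h'

/-- The space `V`, with the module structure over the presented algebra given by `φ`. -/
def Pres {V : Type u} [AddCommGroup V] [Module k V] (_φ : RingQuot r →ₐ[k] Module.End k V) :
    Type u := V

instance {V : Type u} [AddCommGroup V] [Module k V] (φ : RingQuot r →ₐ[k] Module.End k V) :
    AddCommGroup (Pres φ) := inferInstanceAs (AddCommGroup V)

instance {V : Type u} [AddCommGroup V] [Module k V] (φ : RingQuot r →ₐ[k] Module.End k V) :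
    Module (RingQuot r) (Pres φ) := Module.compHom V φ.toRingHom

/-- The identity map of `V`. -/
def Pres.of {V : Type u} [AddCommGroup V] [Module k V] (φ : RingQuot r →ₐ[k] Module.End k V) :
    V ≃+ Pres φ := AddEquiv.refl V

theorem Pres.smul_of {V : Type u} [AddCommGroup V] [Module k V]
    (φ : RingQuot r →ₐ[k] Module.End k V) (a : RingQuot r) (v : V) :
    a • Pres.of φ v = Pres.of φ (φ a v) := rfl

/-- A linear map that commutes with the generators is a morphism of modules. -/
def presMap {V W : Type u} [AddCommGroup V] [Module k V] [AddCommGroup W] [Module k W]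
    (φ : RingQuot r →ₐ[k] Module.End k V) (ψ : RingQuot r →ₐ[k] Module.End k W)
    (f : V →ₗ[k] W) (hf : ∀ x v, f (φ (gen r x) v) = ψ (gen r x) (f v)) :
    Pres φ →ₗ[RingQuot r] Pres ψ where
  toFun v := Pres.of ψ (f ((Pres.of φ).symm v))
  map_add' v w := by simp
  map_smul' a v := by
    obtain ⟨v, rfl⟩ := (Pres.of φ).surjective v
    rw [Pres.smul_of, RingHom.id_apply, AddEquiv.symm_apply_apply, AddEquiv.symm_apply_apply,
      Pres.smul_of]
    congr 1
    induction a using gen_induction generalizing v with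
    | hk c => simp [AlgHom.commutes, Module.algebraMap_end_apply]
    | hX x => exact hf x v
    | hm a b ha hb => simp [ha, hb]
    | ha a b ha hb => simp [ha, hb]

/-- The vector space underlying a module over a presented algebra. -/
def Res (V : ModuleCat.{u} (RingQuot r)) : Type u := V

instance (V : ModuleCat.{u} (RingQuot r)) : AddCommGroup (Res V) :=
  inferInstanceAs (AddCommGroup V)

instance (V : ModuleCat.{u} (RingQuot r)) : Module (RingQuot r) (Res V) :=
  inferInstanceAs (Module (RingQuot r) V)

instance (V : ModuleCat.{u} (RingQuot r)) : Module k (Res V) :=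
  Module.compHom (Res V) (algebraMap k (RingQuot r))

theorem Res.smul_def (V : ModuleCat.{u} (RingQuot r)) (c : k) (v : Res V) :
    c • v = algebraMap k (RingQuot r) c • v := rfl

/-- The `k`-linear action of the generators on a module over a presented algebra. -/
def presAct (V : ModuleCat.{u} (RingQuot r)) : X →ₗ[k] Res V →ₗ[k] Res V :=
  LinearMap.mk₂ k (fun x v => gen r x • v)
    (fun x y v => by rw [map_add, add_smul])
    (fun c x v => by rw [map_smul, Algebra.smul_def, mul_smul, Res.smul_def])
    (fun x v w => smul_add _ _ _)
    (fun c x v => by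
      rw [Res.smul_def, Res.smul_def, ← mul_smul, ← mul_smul, Algebra.commutes])

@[simp]
theorem presAct_apply (V : ModuleCat.{u} (RingQuot r)) (x : X) (v : Res V) :
    presAct V x v = gen r x • v := rfl

/-- A module over a presented algebra is recovered from the action of the generators. -/
def presIso (V : ModuleCat.{u} (RingQuot r)) (φ : RingQuot r →ₐ[k] Module.End k (Res V))
    (hφ : ∀ x (v : Res V), φ (gen r x) v = gen r x • v) :
    Pres φ ≃ₗ[RingQuot r] Res V where
  toAddEquiv := (Pres.of φ).symm
  map_smul' a v := by
    obtain ⟨v, rfl⟩ := (Pres.of φ).surjective v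
    rw [Pres.smul_of]
    change φ a v = a • v
    induction a using gen_induction generalizing v with
    | hk c => rw [AlgHom.commutes, Module.algebraMap_end_apply, Res.smul_def]
    | hX x => exact hφ x v
    | hm a b ha hb => rw [map_mul, Module.End.mul_apply, ha, hb, mul_smul]
    | ha a b ha hb => rw [map_add, LinearMap.add_apply, ha, hb, add_smul]

end Presented

namespace LieMod

variable {k h : Type u} [Field k] [LieRing h] [LieAlgebra k h]

/-- The space of morphisms of right `h`-modules: linear maps compatible with the actions. -/
def homs (M N : LieMod k h) : Submodule k (M.carrier →ₗ[k] N.carrier) where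
  carrier := {f | ∀ m x, f (M.act m x) = N.act (f m) x}
  add_mem' ha hb m x := by simp [ha m x, hb m x]
  zero_mem' m x := by simp
  smul_mem' c f hf m x := by simp [hf m x]

instance : Category (LieMod k h) where
  Hom M N := homs M N
  id M := ⟨LinearMap.id, fun _ _ => rfl⟩
  comp f f' := ⟨f'.1 ∘ₗ f.1, fun m x => by simp [f.2 m x, f'.2 (f.1 m) x]⟩

/-- The linear map underlying a morphism. -/
def toLin {M N : LieMod k h} (f : M ⟶ N) : M.carrier →ₗ[k] N.carrier := f.1

/-- A morphism, from a compatible linear map. -/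
def ofLin {M N : LieMod k h} (f : M.carrier →ₗ[k] N.carrier)
    (hf : ∀ m x, f (M.act m x) = N.act (f m) x) : M ⟶ N := ⟨f, hf⟩

@[ext]
theorem hom_ext {M N : LieMod k h} {f f' : M ⟶ N} (H : ∀ m, toLin f m = toLin f' m) : f = f' :=
  Subtype.ext (LinearMap.ext H)

instance : Preadditive (LieMod k h) where
  homGroup M N := inferInstanceAs (AddCommGroup (homs M N))
  add_comp _ _ _ f f' g := Subtype.ext (LinearMap.comp_add f.1 f'.1 g.1)
  comp_add _ _ _ _ _ _ := Subtype.ext rfl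

instance : Linear k (LieMod k h) where
  homModule M N := inferInstanceAs (Module k (homs M N))
  smul_comp _ _ _ c f g := Subtype.ext (LinearMap.comp_smul g.1 c f.1)
  comp_smul _ _ _ f c g := Subtype.ext (LinearMap.smul_comp c g.1 f.1)

/-- The defining relations of the opposite of the enveloping algebra of `h`. -/
inductive Rel : TensorAlgebra k h → TensorAlgebra k h → Prop
  | lie (x y : h) : Rel
      (TensorAlgebra.ι k ⁅x, y⁆ + TensorAlgebra.ι k x * TensorAlgebra.ι k y)
      (TensorAlgebra.ι k y * TensorAlgebra.ι k x)

/-- The action of the opposite of the enveloping algebra on a right `h`-module. -/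
def rep (M : LieMod k h) : RingQuot (Rel (k := k) (h := h)) →ₐ[k] Module.End k M.carrier :=
  RingQuot.liftAlgHom k ⟨TensorAlgebra.lift k M.act.flip, by
    rintro _ _ ⟨x, y⟩
    ext m
    simp [M.act_lie m x y]⟩

@[simp]
theorem rep_gen (M : LieMod k h) (x : h) (m : M.carrier) :
    rep M (gen Rel x) m = M.act m x := by
  simp [rep, gen]

/-- Right `h`-modules as modules over the opposite of the enveloping algebra. -/
def toModuleCat : LieMod k h ⥤ ModuleCat.{u} (RingQuot (Rel (k := k) (h := h))) where
  obj M := ModuleCat.of _ (Pres (rep M))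
  map {M N} f := ModuleCat.ofHom <| presMap (rep M) (rep N) f.1 fun x v => by simp [f.2 v x]

instance : (toModuleCat (k := k) (h := h)).Faithful where
  map_injective {M N} f f' H := by
    ext m
    exact LinearMap.congr_fun (congrArg ModuleCat.Hom.hom H) (Pres.of (rep M) m)

instance : (toModuleCat (k := k) (h := h)).Full where
  map_surjective {M N} f := by
    let F : M.carrier → N.carrier := fun v => f.hom v
    have hF : ∀ a (v : M.carrier), F (rep M a v) = rep N a (F v) :=
      fun a v => f.hom.map_smul a (Pres.of (rep M) v)
    refine ⟨ofLin
      { toFun := F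
        map_add' := fun v w => f.hom.map_add v w
        map_smul' := fun c v => ?_ } fun m x => ?_, rfl⟩
    · have := hF (algebraMap k _ c) v
      rw [AlgHom.commutes, AlgHom.commutes] at this
      exact this
    · have := hF (gen Rel x) m
      rw [rep_gen, rep_gen] at this
      exact this

instance : (toModuleCat (k := k) (h := h)).EssSurj where
  mem_essImage V := by
    let M : LieMod k h :=
      { carrier := Res V
        act := (presAct V).flip
        act_lie := fun m x y => by
          simp only [LinearMap.flip_apply, presAct_apply]
          have e := RingQuot.mkAlgHom_rel k (Rel.lie (k := k) x y)
          rw [map_add, map_mul, map_mul] at e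
          change gen Rel ⁅x, y⁆ + gen Rel x * gen Rel y = gen Rel y * gen Rel x at e
          rw [eq_sub_iff_add_eq, ← mul_smul, ← mul_smul, ← add_smul, e] }
    exact ⟨M, ⟨(presIso V (rep M) fun x v => rep_gen M x v).toModuleIso⟩⟩

instance : (toModuleCat (k := k) (h := h)).IsEquivalence where

instance : HasFiniteProducts (LieMod k h) :=
  ⟨fun _ => Adjunction.hasLimitsOfShape_of_equivalence toModuleCat⟩

instance : Abelian (LieMod k h) := abelianOfEquivalence toModuleCat

instance : EnoughProjectives (LieMod k h) :=
  (Equivalence.enoughProjectives_iff toModuleCat.asEquivalence).2 inferInstance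

instance : HasExt.{u} (LieMod k h) := hasExt_of_enoughProjectives _

/-- The underlying abelian group of a module. -/
def forgetAb : LieMod k h ⥤ AddCommGrpCat.{u} := toModuleCat ⋙ forget₂ _ _

instance : (forgetAb (k := k) (h := h)).ReflectsIsomorphisms :=
  reflectsIsomorphisms_comp _ _

instance : PreservesFiniteLimits (forgetAb (k := k) (h := h)) :=
  comp_preservesFiniteLimits _ _

instance : PreservesFiniteColimits (forgetAb (k := k) (h := h)) :=
  comp_preservesFiniteColimits _ _

end LieMod

namespace LeibMod

variable {k g : Type u} [Field k] [NonUnitalNonAssocRing g] [Module k g]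

/-- The space of morphisms of `g`-modules: linear maps compatible with both actions. -/
def homs (M N : LeibMod k g) : Submodule k (M.carrier →ₗ[k] N.carrier) where
  carrier := {f | (∀ m x, f (M.ract m x) = N.ract (f m) x) ∧
    ∀ x m, f (M.lact x m) = N.lact x (f m)}
  add_mem' ha hb := ⟨fun m x => by simp [ha.1 m x, hb.1 m x], fun x m => by
    simp [ha.2 x m, hb.2 x m]⟩
  zero_mem' := ⟨fun m x => by simp, fun x m => by simp⟩
  smul_mem' c f hf := ⟨fun m x => by simp [hf.1 m x], fun x m => by simp [hf.2 x m]⟩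

instance : Category (LeibMod k g) where
  Hom M N := homs M N
  id M := ⟨LinearMap.id, fun _ _ => rfl, fun _ _ => rfl⟩
  comp f f' := ⟨f'.1 ∘ₗ f.1, fun m x => by simp [f.2.1 m x, f'.2.1 (f.1 m) x],
    fun x m => by simp [f.2.2 x m, f'.2.2 x (f.1 m)]⟩

/-- The linear map underlying a morphism. -/
def toLin {M N : LeibMod k g} (f : M ⟶ N) : M.carrier →ₗ[k] N.carrier := f.1

/-- A morphism, from a compatible linear map. -/
def ofLin {M N : LeibMod k g} (f : M.carrier →ₗ[k] N.carrier)
    (hr : ∀ m x, f (M.ract m x) = N.ract (f m) x)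
    (hl : ∀ x m, f (M.lact x m) = N.lact x (f m)) : M ⟶ N := ⟨f, hr, hl⟩

@[ext]
theorem hom_ext {M N : LeibMod k g} {f f' : M ⟶ N} (H : ∀ m, toLin f m = toLin f' m) : f = f' :=
  Subtype.ext (LinearMap.ext H)

instance : Preadditive (LeibMod k g) where
  homGroup M N := inferInstanceAs (AddCommGroup (homs M N))
  add_comp _ _ _ f f' g := Subtype.ext (LinearMap.comp_add f.1 f'.1 g.1)
  comp_add _ _ _ _ _ _ := Subtype.ext rfl

instance : Linear k (LeibMod k g) where
  homModule M N := inferInstanceAs (Module k (homs M N))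
  smul_comp _ _ _ c f g := Subtype.ext (LinearMap.comp_smul g.1 c f.1)
  comp_smul _ _ _ f c g := Subtype.ext (LinearMap.smul_comp c g.1 f.1)

/-- The generator `r_x`. -/
abbrev genR (k : Type u) {g : Type u} [Field k] [NonUnitalNonAssocRing g] [Module k g] (x : g) :
    TensorAlgebra k (g × g) := TensorAlgebra.ι k (x, 0)

/-- The generator `l_x`. -/
abbrev genL (k : Type u) {g : Type u} [Field k] [NonUnitalNonAssocRing g] [Module k g] (x : g) :
    TensorAlgebra k (g × g) := TensorAlgebra.ι k (0, x)

/-- The defining relations of the opposite of the enveloping algebra `UL(g)`. -/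
inductive Rel : TensorAlgebra k (g × g) → TensorAlgebra k (g × g) → Prop
  | mll (x y : g) : Rel (genR k (x * y) + genR k x * genR k y) (genR k y * genR k x)
  | lml (x y : g) : Rel (genL k x * genR k y + genL k (x * y)) (genR k y * genL k x)
  | llm (x y : g) : Rel (genL k x * genL k y + genR k y * genL k x) (genL k (x * y))

/-- The action of the opposite of the enveloping algebra on a `g`-module. -/
def rep (M : LeibMod k g) : RingQuot (Rel (k := k) (g := g)) →ₐ[k] Module.End k M.carrier :=
  RingQuot.liftAlgHom k ⟨TensorAlgebra.lift k (M.ract.flip.coprod M.lact), by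
    rintro _ _ (⟨x, y⟩ | ⟨x, y⟩ | ⟨x, y⟩) <;> ext m
    · simp [M.mll m x y]
    · simp [M.lml x m y]
    · simp [M.llm x y m]⟩

@[simp]
theorem rep_gen (M : LeibMod k g) (x : g × g) (m : M.carrier) :
    rep M (gen Rel x) m = M.ract m x.1 + M.lact x.2 m := by
  simp [rep, gen]

/-- `g`-modules as modules over the opposite of the enveloping algebra. -/
def toModuleCat : LeibMod k g ⥤ ModuleCat.{u} (RingQuot (Rel (k := k) (g := g))) where
  obj M := ModuleCat.of _ (Pres (rep M))
  map {M N} f := ModuleCat.ofHom <| presMap (rep M) (rep N) f.1 fun x v => by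
    simp [f.2.1 v x.1, f.2.2 x.2 v]

instance : (toModuleCat (k := k) (g := g)).Faithful where
  map_injective {M N} f f' H := by
    ext m
    exact LinearMap.congr_fun (congrArg ModuleCat.Hom.hom H) (Pres.of (rep M) m)

instance : (toModuleCat (k := k) (g := g)).Full where
  map_surjective {M N} f := by
    let F : M.carrier → N.carrier := fun v => f.hom v
    have hF : ∀ a (v : M.carrier), F (rep M a v) = rep N a (F v) :=
      fun a v => f.hom.map_smul a (Pres.of (rep M) v)
    refine ⟨ofLin
      { toFun := F
        map_add' := fun v w => f.hom.map_add v w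
        map_smul' := fun c v => ?_ } (fun m x => ?_) fun x m => ?_, rfl⟩
    · have := hF (algebraMap k _ c) v
      rw [AlgHom.commutes, AlgHom.commutes] at this
      exact this
    · have := hF (gen Rel (x, 0)) m
      rw [rep_gen, rep_gen] at this
      simp only [map_zero, LinearMap.zero_apply, add_zero] at this
      exact this
    · have := hF (gen Rel (0, x)) m
      rw [rep_gen, rep_gen] at this
      simp only [map_zero, zero_add] at this
      exact this

theorem gen_mll (x y : g) :
    gen (Rel (k := k)) (x * y, 0) + gen (Rel (k := k)) (x, 0) * gen (Rel (k := k)) (y, 0) =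
      gen (Rel (k := k)) (y, 0) * gen (Rel (k := k)) (x, 0) := by
  simpa [gen] using RingQuot.mkAlgHom_rel k (Rel.mll (k := k) x y)

theorem gen_lml (x y : g) :
    gen (Rel (k := k)) (0, x) * gen (Rel (k := k)) (y, 0) + gen (Rel (k := k)) (0, x * y) =
      gen (Rel (k := k)) (y, 0) * gen (Rel (k := k)) (0, x) := by
  simpa [gen] using RingQuot.mkAlgHom_rel k (Rel.lml (k := k) x y)

theorem gen_llm (x y : g) :
    gen (Rel (k := k)) (0, x) * gen (Rel (k := k)) (0, y) +
        gen (Rel (k := k)) (y, 0) * gen (Rel (k := k)) (0, x) =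
      gen (Rel (k := k)) (0, x * y) := by
  simpa [gen] using RingQuot.mkAlgHom_rel k (Rel.llm (k := k) x y)

/-- The `g`-module attached to a module over the opposite of the enveloping algebra. -/
def ofModule (V : ModuleCat.{u} (RingQuot (Rel (k := k) (g := g)))) : LeibMod k g where
  carrier := Res V
  ract := (presAct V ∘ₗ LinearMap.inl k g g).flip
  lact := presAct V ∘ₗ LinearMap.inr k g g
  mll m x y := by
    simp only [LinearMap.flip_apply, LinearMap.comp_apply, presAct_apply, LinearMap.inl_apply]
    rw [eq_sub_iff_add_eq, ← mul_smul, ← mul_smul, ← add_smul, gen_mll]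
  lml x m y := by
    simp only [LinearMap.flip_apply, LinearMap.comp_apply, presAct_apply, LinearMap.inl_apply,
      LinearMap.inr_apply]
    rw [eq_sub_iff_add_eq, ← mul_smul, ← mul_smul, ← add_smul, gen_lml]
  llm x y m := by
    simp only [LinearMap.flip_apply, LinearMap.comp_apply, presAct_apply, LinearMap.inl_apply,
      LinearMap.inr_apply]
    rw [eq_sub_iff_add_eq, ← mul_smul, ← mul_smul, ← add_smul, gen_llm]

theorem rep_ofModule (V : ModuleCat.{u} (RingQuot (Rel (k := k) (g := g)))) (x : g × g)
    (v : Res V) : rep (ofModule V) (gen Rel x) v = gen (Rel (k := k)) x • v := by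
  refine (rep_gen (ofModule V) x v).trans ?_
  change gen (Rel (k := k)) (x.1, 0) • v + gen (Rel (k := k)) (0, x.2) • v =
    gen (Rel (k := k)) x • v
  rw [← add_smul, ← map_add, Prod.mk_add_mk, add_zero, zero_add]

instance : (toModuleCat (k := k) (g := g)).EssSurj where
  mem_essImage V := ⟨ofModule V, ⟨(presIso V (rep (ofModule V)) (rep_ofModule V)).toModuleIso⟩⟩

instance : (toModuleCat (k := k) (g := g)).IsEquivalence where

instance : HasFiniteProducts (LeibMod k g) :=
  ⟨fun _ => Adjunction.hasLimitsOfShape_of_equivalence toModuleCat⟩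

instance : Abelian (LeibMod k g) := abelianOfEquivalence toModuleCat

instance : EnoughProjectives (LeibMod k g) :=
  (Equivalence.enoughProjectives_iff toModuleCat.asEquivalence).2 inferInstance

instance : HasExt.{u} (LeibMod k g) := hasExt_of_enoughProjectives _

/-- The underlying abelian group of a module. -/
def forgetAb : LeibMod k g ⥤ AddCommGrpCat.{u} := toModuleCat ⋙ forget₂ _ _

instance : (forgetAb (k := k) (g := g)).ReflectsIsomorphisms :=
  reflectsIsomorphisms_comp _ _

instance : PreservesFiniteLimits (forgetAb (k := k) (g := g)) :=
  comp_preservesFiniteLimits _ _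

instance : PreservesFiniteColimits (forgetAb (k := k) (g := g)) :=
  comp_preservesFiniteColimits _ _

end LeibMod

/-! ### Symmetric and antisymmetric modules -/

section Functors

variable {k g : Type u} [Field k] [NonUnitalNonAssocRing g] [Module k g]
  [IsScalarTower k g g] [SMulCommClass k g g] [IsLeibniz g]

/-- The symmetric `g`-module `N^s` on the right `g_Lie`-module `N`: `n x = n x̄` and
`x n = - n x̄`. -/
def symObj (N : LieMod k (LieQuot k g)) : LeibMod k g where
  carrier := N.carrier
  ract := N.act.compl₂ (toLie k g)
  lact := - (N.act.compl₂ (toLie k g)).flip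
  mll m x y := by simp [← toLie_bracket, N.act_lie]
  lml x m y := by simp [← toLie_bracket, N.act_lie]; abel
  llm x y m := by simp [← toLie_bracket, N.act_lie]

/-- The antisymmetric `g`-module `N^a` on the right `g_Lie`-module `N`: `n x = n x̄` and
`x n = 0`. -/
def asymObj (N : LieMod k (LieQuot k g)) : LeibMod k g where
  carrier := N.carrier
  ract := N.act.compl₂ (toLie k g)
  lact := 0
  mll m x y := by simp [← toLie_bracket, N.act_lie]
  lml x m y := by simp
  llm x y m := by simp

variable (k g)

/-- The functor `(-)^s`, the identity on underlying linear maps. -/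
def symFunctor : LieMod k (LieQuot k g) ⥤ LeibMod k g where
  obj N := symObj N
  map f := LeibMod.ofLin f.1 (fun m x => f.2 m _)
    (fun x m => (map_neg f.1 _).trans (congrArg Neg.neg (f.2 m _)))

/-- The functor `(-)^a`, the identity on underlying linear maps. -/
def asymFunctor : LieMod k (LieQuot k g) ⥤ LeibMod k g where
  obj N := asymObj N
  map f := LeibMod.ofLin f.1 (fun m x => f.2 m _) (fun _ _ => map_zero f.1)

instance : (symFunctor k g).Additive where
instance : (asymFunctor k g).Additive where
instance : (symFunctor k g).Linear k where
instance : (asymFunctor k g).Linear k where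

/-- A functor from right `g_Lie`-modules to `g`-modules that does not change the underlying
abelian groups is left exact. -/
theorem preservesFiniteLimits_of_forgetAb (F : LieMod k (LieQuot k g) ⥤ LeibMod k g)
    (e : F ⋙ LeibMod.forgetAb ≅ LieMod.forgetAb) : PreservesFiniteLimits F where
  preservesFiniteLimits J _ _ := by
    have : PreservesLimitsOfShape J (F ⋙ LeibMod.forgetAb) :=
      preservesLimitsOfShape_of_natIso e.symm
    have : ReflectsLimitsOfShape J (LeibMod.forgetAb (k := k) (g := g)) :=
      reflectsLimitsOfShape_of_reflectsIsomorphisms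
    exact preservesLimitsOfShape_of_reflects_of_preserves F LeibMod.forgetAb

/-- A functor from right `g_Lie`-modules to `g`-modules that does not change the underlying
abelian groups is right exact. -/
theorem preservesFiniteColimits_of_forgetAb (F : LieMod k (LieQuot k g) ⥤ LeibMod k g)
    (e : F ⋙ LeibMod.forgetAb ≅ LieMod.forgetAb) : PreservesFiniteColimits F where
  preservesFiniteColimits J _ _ := by
    have : PreservesColimitsOfShape J (F ⋙ LeibMod.forgetAb) :=
      preservesColimitsOfShape_of_natIso e.symm
    have : ReflectsColimitsOfShape J (LeibMod.forgetAb (k := k) (g := g)) :=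
      reflectsColimitsOfShape_of_reflectsIsomorphisms
    exact preservesColimitsOfShape_of_reflects_of_preserves F LeibMod.forgetAb

instance : PreservesFiniteLimits (symFunctor k g) :=
  preservesFiniteLimits_of_forgetAb k g _ (NatIso.ofComponents fun _ => Iso.refl _)

instance : PreservesFiniteColimits (symFunctor k g) :=
  preservesFiniteColimits_of_forgetAb k g _ (NatIso.ofComponents fun _ => Iso.refl _)

instance : PreservesFiniteLimits (asymFunctor k g) :=
  preservesFiniteLimits_of_forgetAb k g _ (NatIso.ofComponents fun _ => Iso.refl _)

instance : PreservesFiniteColimits (asymFunctor k g) :=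
  preservesFiniteColimits_of_forgetAb k g _ (NatIso.ofComponents fun _ => Iso.refl _)

end Functors

/-! ### Tensor products and internal homs of right modules over a Lie algebra -/

section Closed

variable {k h : Type u} [Field k] [LieRing h] [LieAlgebra k h]

/-- The diagonal action `(n ⊗ p) y = n y ⊗ p + n ⊗ p y` on a tensor product. -/
def tensorAct (N P : LieMod k h) :
    N.carrier ⊗[k] P.carrier →ₗ[k] h →ₗ[k] N.carrier ⊗[k] P.carrier :=
  LinearMap.mk₂ k
    (fun t y => (N.act.flip y).rTensor P.carrier t + (P.act.flip y).lTensor N.carrier t)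
    (fun t t' y => by simp only [map_add]; abel)
    (fun c t y => by simp only [map_smul, smul_add])
    (fun t y y' => by
      simp only [map_add, LinearMap.rTensor_add, LinearMap.lTensor_add, LinearMap.add_apply]; abel)
    (fun c t y => by
      simp only [map_smul, LinearMap.rTensor_smul, LinearMap.lTensor_smul, LinearMap.smul_apply,
        smul_add])

@[simp]
theorem tensorAct_tmul (N P : LieMod k h) (n : N.carrier) (p : P.carrier) (y : h) :
    tensorAct N P (n ⊗ₜ p) y = N.act n y ⊗ₜ p + n ⊗ₜ P.act p y := rfl

/-- The tensor product `N ⊗ P` with the diagonal action. -/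
def tensorMod (N P : LieMod k h) : LieMod k h where
  carrier := N.carrier ⊗[k] P.carrier
  act := tensorAct N P
  act_lie t x y := by
    induction t using TensorProduct.induction_on with
    | zero => simp
    | add t t' ht ht' =>
      simp only [map_add, LinearMap.add_apply] at ht ht' ⊢
      rw [ht, ht']; abel
    | tmul n p =>
      simp only [tensorAct_tmul, map_add, LinearMap.add_apply, N.act_lie, P.act_lie,
        TensorProduct.sub_tmul, TensorProduct.tmul_sub]
      abel

/-- The space `Hom_k(P, N)` of linear maps with the diagonal action
`(f y)(p) = f(p) y - f(p y)`. -/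
def homMod (P N : LieMod k h) : LieMod k h where
  carrier := P.carrier →ₗ[k] N.carrier
  act := LinearMap.mk₂ k
    (fun f y => N.act.flip y ∘ₗ f - f ∘ₗ P.act.flip y)
    (fun f f' y => by ext p; simp; abel)
    (fun c f y => by ext p; simp [smul_sub])
    (fun f y y' => by ext p; simp; abel)
    (fun c f y => by ext p; simp [smul_sub])
  act_lie f x y := by
    ext p
    simp [N.act_lie, P.act_lie]
    abel

end Closed

/-! ### The Loday-Pirashvili type extensions -/

section Extensions

variable {k g : Type u} [Field k] [NonUnitalNonAssocRing g] [Module k g]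
  [IsScalarTower k g g] [SMulCommClass k g g] [IsLeibniz g]

variable (k g) in
/-- The adjoint module restricted to its right action: `g` as a right `g_Lie`-module. -/
def down : LieMod k (LieQuot k g) where
  carrier := g
  act := adj k g
  act_lie m a b := by
    obtain ⟨x, rfl⟩ := toLie_surjective k g a
    obtain ⟨y, rfl⟩ := toLie_surjective k g b
    exact IsLeibniz.leibniz m x y

/-- The tensor `n ⊗ x` in `N ⊗ g`, as a bilinear map. -/
def tens (N : LieMod k (LieQuot k g)) :
    N.carrier →ₗ[k] g →ₗ[k] (tensorMod N (down k g)).carrier :=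
  TensorProduct.mk k N.carrier g

theorem tens_act (N : LieMod k (LieQuot k g)) (n : N.carrier) (x y : g) :
    (tensorMod N (down k g)).act (tens N n x) (toLie k g y) =
      tens N (N.act n (toLie k g y)) x + tens N n (x * y) := rfl

/-- The `g`-module `lext(N)`: the space `(N ⊗ g) × N` with the actions
`[t, n] y = [t y, n y]`, for the diagonal action on `N ⊗ g`, and `z [t, n] = [n ⊗ z, - n z]`. -/
def lext (N : LieMod k (LieQuot k g)) : LeibMod k g where
  carrier := (tensorMod N (down k g)).carrier × N.carrier
  ract := LinearMap.mk₂ k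
    (fun p y => ((tensorMod N (down k g)).act p.1 (toLie k g y), N.act p.2 (toLie k g y)))
    (fun p p' y => by simp)
    (fun c p y => by simp)
    (fun p y y' => by simp)
    (fun c p y => by simp)
  lact := LinearMap.mk₂ k
    (fun z p => (tens N p.2 z, - N.act p.2 (toLie k g z)))
    (fun z z' p => by simp [add_comm])
    (fun c z p => by simp)
    (fun z p p' => by simp [add_comm])
    (fun c z p => by simp)
  mll m x y := by
    simp only [LinearMap.mk₂_apply, ← toLie_bracket, LieMod.act_lie, Prod.mk_sub_mk]
  lml x m y := by
    simp only [LinearMap.mk₂_apply, tens_act, Prod.mk_sub_mk, ← toLie_bracket, LieMod.act_lie,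
      map_neg, LinearMap.neg_apply]
    congr 1 <;> abel
  llm x y m := by
    simp only [LinearMap.mk₂_apply, tens_act, Prod.mk_sub_mk, ← toLie_bracket, LieMod.act_lie,
      map_neg, LinearMap.neg_apply]
    congr 1 <;> abel

/-- The canonical surjection `lext(N) → N^s`. -/
def lextProj (N : LieMod k (LieQuot k g)) : lext N ⟶ (symFunctor k g).obj N :=
  LeibMod.ofLin (LinearMap.snd k (tensorMod N (down k g)).carrier N.carrier)
    (fun _ _ => rfl) (fun _ _ => rfl)

/-- The value `f(x)` for `f` in `Hom_k(g, N)` and `x` in `g`, as a bilinear map. -/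
def evalHom (N : LieMod k (LieQuot k g)) :
    (homMod (down k g) N).carrier →ₗ[k] g →ₗ[k] N.carrier :=
  LinearMap.id (M := g →ₗ[k] N.carrier)

theorem evalHom_act (N : LieMod k (LieQuot k g)) (f : (homMod (down k g) N).carrier) (x y : g) :
    evalHom N ((homMod (down k g) N).act f (toLie k g y)) x =
      N.act (evalHom N f x) (toLie k g y) - evalHom N f (x * y) := rfl

/-- The `g`-module `rext(N)`: the space `N × Hom_k(g, N)` with the actions
`[n, f] y = [n y, f y]`, for the diagonal action on `Hom_k(g, N)`, and
`z [n, f] = [f(z), - f z]`. -/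
def rext (N : LieMod k (LieQuot k g)) : LeibMod k g where
  carrier := N.carrier × (homMod (down k g) N).carrier
  ract := LinearMap.mk₂ k
    (fun p y => (N.act p.1 (toLie k g y), (homMod (down k g) N).act p.2 (toLie k g y)))
    (fun p p' y => by simp)
    (fun c p y => by simp)
    (fun p y y' => by simp)
    (fun c p y => by simp)
  lact := LinearMap.mk₂ k
    (fun z p => (evalHom N p.2 z, - (homMod (down k g) N).act p.2 (toLie k g z)))
    (fun z z' p => by simp [add_comm])
    (fun c z p => by simp)
    (fun z p p' => by simp [add_comm])
    (fun c z p => by simp)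
  mll m x y := by
    simp only [LinearMap.mk₂_apply, ← toLie_bracket, LieMod.act_lie, Prod.mk_sub_mk]
  lml x m y := by
    simp only [LinearMap.mk₂_apply, evalHom_act, Prod.mk_sub_mk, ← toLie_bracket, LieMod.act_lie,
      map_neg, LinearMap.neg_apply]
    congr 1; abel
  llm x y m := by
    simp only [LinearMap.mk₂_apply, evalHom_act, Prod.mk_sub_mk, ← toLie_bracket, LieMod.act_lie,
      map_neg, LinearMap.neg_apply]
    congr 1 <;> abel

/-- The canonical inclusion `N^a → rext(N)`. -/
def rextIncl (N : LieMod k (LieQuot k g)) : (asymFunctor k g).obj N ⟶ rext N :=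
  LeibMod.ofLin (LinearMap.inl k N.carrier (homMod (down k g) N).carrier)
    (fun m x => by
      change ((_ : N.carrier), (0 : (homMod (down k g) N).carrier)) =
        (_, (homMod (down k g) N).act 0 (toLie k g x))
      rw [map_zero]; rfl)
    (fun x m => by
      change ((0 : N.carrier), (0 : (homMod (down k g) N).carrier)) =
        (evalHom N 0 x, - (homMod (down k g) N).act 0 (toLie k g x))
      simp)

end Extensions

end

end LeibnizExt

/-! Forgetting the left action gives a functor `rightFunctor` from g-modules to right g_Lie-modules,
and `lext` and `rext` are its left and right adjoints. Since the right module underlying N^s or N^a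
is N itself, adjunction gives Hom(lext(N₁), N₂^s) = Hom(N₁, N₂) = Hom(N₁^a, rext(N₂)). The canonical
surjection and inclusion realise these identifications, which is the claim in degree 0
(`bijective_lextProj_comp`, `bijective_comp_rextIncl`).

Higher degrees follow by dimension shifting. Having adjoints on both sides, `rightFunctor` preserves
epimorphisms and monomorphisms, so `lext` preserves projectives and `rext` preserves injectives.
Both are also exact, because k is a field. Hence a projective presentation of N₁ yields, through
`lext`, a presentation with projective middle term, and the long exact sequences of Ext(-, N₂) and
Ext(lext(-), N₂^s) present degree n + 1 as a cokernel in degree n. The comparison maps commute with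
the connecting maps because extension classes are natural along lext → (-)^s. Injective
presentations of N₂ and (-)^a → rext give the second claim. The induction is carried out for
arbitrary exact functors in `bijective_comp_mapExactFunctor_of_projective` and
`bijective_comp_mapExactFunctor_of_injective`. -/

/-! ### Maps on `Ext` twisted by a natural transformation -/

section TwistedExt

universe w w' v v' u₁ u₁'

open CategoryTheory.Abelian

variable {C : Type u₁} [Category.{v} C] [Abelian C] {D : Type u₁'} [Category.{v'} D] [Abelian D]
  [HasExt.{w} C] [HasExt.{w'} D]
  (F G : C ⥤ D) [F.Additive] [PreservesFiniteLimits F] [PreservesFiniteColimits F]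
  [G.Additive] [PreservesFiniteLimits G] [PreservesFiniteColimits G]

attribute [local instance] Ext.subsingleton_of_projective in
/-- Let `τ : G ⟶ F` be a natural transformation of exact functors such that `G` preserves
projective objects. If `f ↦ τ ≫ F f` is a bijection on morphisms to `Y`, then the analogous map on
`Ext` is a bijection in every degree. -/
theorem CategoryTheory.Abelian.Ext.bijective_comp_mapExactFunctor_of_projective
    [EnoughProjectives C] [G.PreservesProjectiveObjects] (τ : G ⟶ F) (Y : C)
    (h₀ : ∀ X : C, Function.Bijective fun f : X ⟶ Y => τ.app X ≫ F.map f) (X : C) (n : ℕ) :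
    Function.Bijective (((mk₀ (τ.app X)).precomp (F.obj Y) (zero_add n)).comp
      (F.mapExtAddHom X Y n)) := by
  induction n generalizing X with
  | zero =>
    -- Under Ext⁰ = Hom the map becomes f ↦ τ ≫ F f, so `h₀` settles degree 0.
    have e : ⇑(((mk₀ (τ.app X)).precomp (F.obj Y) (zero_add 0)).comp (F.mapExtAddHom X Y 0)) =
        homEquiv₀.symm ∘ (fun f : X ⟶ Y => τ.app X ≫ F.map f) ∘ homEquiv₀ := by
      ext x
      obtain ⟨f, rfl⟩ := (mk₀_bijective X Y).2 x
      simp [mapExactFunctor_mk₀, homEquiv₀]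
    rw [e]
    exact homEquiv₀.symm.bijective.comp ((h₀ X).comp homEquiv₀.bijective)
  | succ n hn =>
    let P : ProjectivePresentation X := Classical.arbitrary _
    let S := ShortComplex.mk _ _ (kernel.condition P.f)
    have : Projective S.X₂ := P.projective
    -- The one use of the hypothesis that G preserves projectives: the positive Ext groups out of
    -- the middle term of the G-image of S vanish too.
    have : Projective (S.map G).X₂ := G.projective_obj_of_projective P.projective
    have hS : S.ShortExact := { exact := ShortComplex.exact_kernel P.f }
    -- Each row is Extⁿ of the middle term → Extⁿ of the kernel → Extⁿ⁺¹ of the quotient → 0, exact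
    -- on the right because Extⁿ⁺¹ of the projective middle term is zero. A map of such rows that is
    -- surjective on the first terms and bijective on the second is bijective on the third.
    refine AddMonoidHom.bijective_of_surjective_of_bijective_of_right_exact
      ((mk₀ S.f).precomp Y (zero_add n)) (hS.extClass.precomp Y (add_comm 1 n))
      ((mk₀ (S.map G).f).precomp (F.obj Y) (zero_add n))
      ((hS.map_of_exact G).extClass.precomp (F.obj Y) (add_comm 1 n))
      (((mk₀ (τ.app S.X₂)).precomp (F.obj Y) (zero_add n)).comp (F.mapExtAddHom S.X₂ Y n))
      (((mk₀ (τ.app S.X₁)).precomp (F.obj Y) (zero_add n)).comp (F.mapExtAddHom S.X₁ Y n))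
      (((mk₀ (τ.app S.X₃)).precomp (F.obj Y) (zero_add (n + 1))).comp
        (F.mapExtAddHom S.X₃ Y (n + 1)))
      ?_ ?_
      ((ShortComplex.ab_exact_iff_function_exact _).1
        (Ext.contravariant_sequence_exact₁' hS Y n (n + 1) (add_comm 1 n)))
      ((ShortComplex.ab_exact_iff_function_exact _).1
        (Ext.contravariant_sequence_exact₁' (hS.map_of_exact G) (F.obj Y) n (n + 1)
          (add_comm 1 n)))
      -- The induction hypothesis is applied to the projective and to the kernel, not to X; hence
      -- the generalisation over X.
      (hn _).surjective (hn _)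
      (fun x₃ ↦ Ext.contravariant_sequence_exact₃ hS _ x₃ (Subsingleton.elim _ _) (add_comm 1 n))
      (fun y₃ ↦ Ext.contravariant_sequence_exact₃ (hS.map_of_exact G) _ y₃
        (Subsingleton.elim (α := Ext (S.map G).X₂ (F.obj Y) (n + 1)) _ _) (add_comm 1 n))
    · ext x
      change (mk₀ (G.map S.f)).comp ((mk₀ (τ.app S.X₂)).comp (x.mapExactFunctor F) (zero_add _)) (zero_add _) =
        (mk₀ (τ.app S.X₁)).comp (((mk₀ S.f).comp x (zero_add _)).mapExactFunctor F) (zero_add _)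
      rw [mapExactFunctor_comp, mapExactFunctor_mk₀, mk₀_comp_mk₀_assoc, mk₀_comp_mk₀_assoc,
        τ.naturality]
    · ext x
      let γF : Ext (F.obj S.X₃) (F.obj S.X₁) 1 := (hS.map_of_exact F).extClass
      let γG : Ext (G.obj S.X₃) (G.obj S.X₁) 1 := (hS.map_of_exact G).extClass
      -- τ is a morphism from the short exact sequence G S to F S, so pushing out the class of G S
      -- along τ at the kernel agrees with pulling back the class of F S along τ at the quotient.
      -- This makes the square of connecting maps commute.
      have e : γG.comp (mk₀ (τ.app S.X₁)) (add_zero 1) = (mk₀ (τ.app S.X₃)).comp γF (zero_add 1) :=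
        (hS.map_of_exact G).extClass_naturality (hS.map_of_exact F) (S.mapNatTrans τ)
      change γG.comp ((mk₀ (τ.app S.X₁)).comp (x.mapExactFunctor F) (zero_add n)) (add_comm 1 n) =
        (mk₀ (τ.app S.X₃)).comp ((hS.extClass.comp x (add_comm 1 n)).mapExactFunctor F) (zero_add _)
      rw [mapExactFunctor_comp, mapExactFunctor_extClass,
        ← comp_assoc (a := n + 1) _ _ _ (add_zero 1) (zero_add n) (by omega), e,
        comp_assoc (a := n + 1) _ _ _ (zero_add 1) (add_comm 1 n) (by omega)]

attribute [local instance] Ext.subsingleton_of_injective in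
/-- Let `τ : F ⟶ G` be a natural transformation of exact functors such that `G` preserves
injective objects. If `f ↦ F f ≫ τ` is a bijection on morphisms from `X`, then the analogous map
on `Ext` is a bijection in every degree. -/
theorem CategoryTheory.Abelian.Ext.bijective_comp_mapExactFunctor_of_injective
    [EnoughInjectives C] [G.PreservesInjectiveObjects] (τ : F ⟶ G) (X : C)
    (h₀ : ∀ Y : C, Function.Bijective fun f : X ⟶ Y => F.map f ≫ τ.app Y) (Y : C) (n : ℕ) :
    Function.Bijective (((mk₀ (τ.app Y)).postcomp (F.obj X) (add_zero n)).comp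
      (F.mapExtAddHom X Y n)) := by
  induction n generalizing Y with
  | zero =>
    have e : ⇑(((mk₀ (τ.app Y)).postcomp (F.obj X) (add_zero 0)).comp (F.mapExtAddHom X Y 0)) =
        homEquiv₀.symm ∘ (fun f : X ⟶ Y => F.map f ≫ τ.app Y) ∘ homEquiv₀ := by
      ext x
      obtain ⟨f, rfl⟩ := (mk₀_bijective X Y).2 x
      simp [mapExactFunctor_mk₀, homEquiv₀]
    rw [e]
    exact homEquiv₀.symm.bijective.comp ((h₀ Y).comp homEquiv₀.bijective)
  | succ n hn =>
    let I : InjectivePresentation Y := Classical.arbitrary _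
    let S := ShortComplex.mk _ _ (cokernel.condition I.f)
    have : Injective S.X₂ := I.injective
    have : Injective (S.map G).X₂ := G.injective_obj_of_injective I.injective
    have hS : S.ShortExact := { exact := ShortComplex.exact_cokernel I.f }
    -- Dual dimension shift: Extⁿ⁺¹ into Y is the cokernel of Extⁿ into the injective → Extⁿ into
    -- its quotient by Y, and likewise after applying G.
    refine AddMonoidHom.bijective_of_surjective_of_bijective_of_right_exact
      ((mk₀ S.g).postcomp X (add_zero n)) (hS.extClass.postcomp X rfl)
      ((mk₀ (S.map G).g).postcomp (F.obj X) (add_zero n))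
      ((hS.map_of_exact G).extClass.postcomp (F.obj X) rfl)
      (((mk₀ (τ.app S.X₂)).postcomp (F.obj X) (add_zero n)).comp (F.mapExtAddHom X S.X₂ n))
      (((mk₀ (τ.app S.X₃)).postcomp (F.obj X) (add_zero n)).comp (F.mapExtAddHom X S.X₃ n))
      (((mk₀ (τ.app S.X₁)).postcomp (F.obj X) (add_zero (n + 1))).comp
        (F.mapExtAddHom X S.X₁ (n + 1)))
      ?_ ?_
      ((ShortComplex.ab_exact_iff_function_exact _).1
        (Ext.covariant_sequence_exact₃' X hS n (n + 1) rfl))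
      ((ShortComplex.ab_exact_iff_function_exact _).1
        (Ext.covariant_sequence_exact₃' (F.obj X) (hS.map_of_exact G) n (n + 1) rfl))
      (hn _).surjective (hn _)
      (fun x₁ ↦ Ext.covariant_sequence_exact₁ _ hS x₁ (Subsingleton.elim _ _) rfl)
      (fun y₁ ↦ Ext.covariant_sequence_exact₁ _ (hS.map_of_exact G) y₁
        (Subsingleton.elim (α := Ext (F.obj X) (S.map G).X₂ (n + 1)) _ _) rfl)
    · ext x
      change ((x.mapExactFunctor F).comp (mk₀ (τ.app S.X₂)) (add_zero _)).comp (mk₀ (G.map S.g)) (add_zero _) =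
        ((x.comp (mk₀ S.g) (add_zero _)).mapExactFunctor F).comp (mk₀ (τ.app S.X₃)) (add_zero _)
      rw [mapExactFunctor_comp, mapExactFunctor_mk₀, comp_assoc_of_third_deg_zero,
        comp_assoc_of_third_deg_zero, mk₀_comp_mk₀, mk₀_comp_mk₀, τ.naturality]
    · ext x
      let γF : Ext (F.obj S.X₃) (F.obj S.X₁) 1 := (hS.map_of_exact F).extClass
      let γG : Ext (G.obj S.X₃) (G.obj S.X₁) 1 := (hS.map_of_exact G).extClass
      -- Here τ goes from F to G, so it is the class of F S that is pushed out and the class of G S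
      -- that is pulled back.
      have e : γF.comp (mk₀ (τ.app S.X₁)) (add_zero 1) = (mk₀ (τ.app S.X₃)).comp γG (zero_add 1) :=
        (hS.map_of_exact F).extClass_naturality (hS.map_of_exact G) (S.mapNatTrans τ)
      change ((x.mapExactFunctor F).comp (mk₀ (τ.app S.X₃)) (add_zero n)).comp γG rfl =
        ((x.comp hS.extClass rfl).mapExactFunctor F).comp (mk₀ (τ.app S.X₁)) (add_zero _)
      rw [mapExactFunctor_comp, mapExactFunctor_extClass,
        comp_assoc (a := n + 1) _ _ _ (add_zero n) (zero_add 1) (by omega), ← e,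
        ← comp_assoc (a := n + 1) _ _ _ rfl (add_zero 1) (by omega)]

end TwistedExt

/-! ### Monomorphisms, epimorphisms and injectives in the module categories -/

namespace LeibnizExt

noncomputable section

/-- The forgetful functor to abelian groups preserves and reflects monomorphisms and epimorphisms.
With the three statements that follow, this reduces exactness of `lext` and `rext` to linear
algebra. -/
theorem LieMod.mono_iff_injective {k h : Type u} [Field k] [LieRing h] [LieAlgebra k h]
    {M N : LieMod k h} (f : M ⟶ N) : Mono f ↔ Function.Injective (LieMod.toLin f) :=
  ⟨fun _ => (AddCommGrpCat.mono_iff_injective (LieMod.forgetAb.map f)).1 inferInstance,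
    fun H => LieMod.forgetAb.mono_of_mono_map ((AddCommGrpCat.mono_iff_injective _).2 H)⟩

theorem LieMod.epi_iff_surjective {k h : Type u} [Field k] [LieRing h] [LieAlgebra k h]
    {M N : LieMod k h} (f : M ⟶ N) : Epi f ↔ Function.Surjective (LieMod.toLin f) :=
  ⟨fun _ => (AddCommGrpCat.epi_iff_surjective (LieMod.forgetAb.map f)).1 inferInstance,
    fun H => LieMod.forgetAb.epi_of_epi_map ((AddCommGrpCat.epi_iff_surjective _).2 H)⟩

theorem LeibMod.mono_of_injective {k g : Type u} [Field k] [NonUnitalNonAssocRing g] [Module k g]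
    {M N : LeibMod k g} (f : M ⟶ N) (H : Function.Injective (LeibMod.toLin f)) : Mono f :=
  LeibMod.forgetAb.mono_of_mono_map ((AddCommGrpCat.mono_iff_injective _).2 H)

theorem LeibMod.epi_of_surjective {k g : Type u} [Field k] [NonUnitalNonAssocRing g] [Module k g]
    {M N : LeibMod k g} (f : M ⟶ N) (H : Function.Surjective (LeibMod.toLin f)) : Epi f :=
  LeibMod.forgetAb.epi_of_epi_map ((AddCommGrpCat.epi_iff_surjective _).2 H)

instance {k h : Type u} [Field k] [LieRing h] [LieAlgebra k h] : EnoughInjectives (LieMod k h) :=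
  EnoughInjectives.of_equivalence LieMod.toModuleCat

variable (k g : Type u) [Field k] [NonUnitalNonAssocRing g] [Module k g]
  [IsScalarTower k g g] [SMulCommClass k g g] [IsLeibniz g]

/-! ### The right module underlying a module over a Leibniz algebra -/

variable {k g} in
/-- The right `g_Lie`-module underlying a `g`-module. -/
def rightObj (M : LeibMod k g) : LieMod k (LieQuot k g) where
  carrier := M.carrier
  act := LinearMap.flip <| (squares k g).liftQ M.ract.flip <| by
    rw [squares, Submodule.span_le]
    rintro _ ⟨y, rfl⟩
    ext m
    -- The relation MLL with both arguments equal to y gives m(yy) = 0.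
    simp [M.mll m y y]
  act_lie m a b := by
    obtain ⟨x, rfl⟩ := toLie_surjective k g a
    obtain ⟨y, rfl⟩ := toLie_surjective k g b
    exact M.mll m x y

/-- The functor that forgets the left action of a `g`-module. -/
def rightFunctor : LeibMod k g ⥤ LieMod k (LieQuot k g) where
  obj M := rightObj M
  map f := LieMod.ofLin f.1 fun m a => by
    obtain ⟨x, rfl⟩ := toLie_surjective k g a
    exact f.2.1 m x

/-! ### The functor `lext` -/

variable {k g} in
theorem tens_ext {N : LieMod k (LieQuot k g)} {V : Type u} [AddCommGroup V] [Module k V]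
    {φ ψ : (tensorMod N (down k g)).carrier →ₗ[k] V}
    (H : ∀ n x, φ (tens N n x) = ψ (tens N n x)) : φ = ψ :=
  TensorProduct.ext' H

variable {k g} in
/-- The linear map on `N ⊗ g` attached to a bilinear map on `N × g`. -/
def tensLift {N : LieMod k (LieQuot k g)} {V : Type u} [AddCommGroup V] [Module k V]
    (B : N.carrier →ₗ[k] g →ₗ[k] V) : (tensorMod N (down k g)).carrier →ₗ[k] V :=
  TensorProduct.lift B

variable {k g} in
@[simp]
theorem tensLift_tens {N : LieMod k (LieQuot k g)} {V : Type u} [AddCommGroup V] [Module k V]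
    (B : N.carrier →ₗ[k] g →ₗ[k] V) (n : N.carrier) (x : g) :
    tensLift B (tens N n x) = B n x := rfl

variable {k g} in
/-- The linear map `f ⊗ g`. -/
def tensMap {M N : LieMod k (LieQuot k g)} (f : M ⟶ N) :
    (tensorMod M (down k g)).carrier →ₗ[k] (tensorMod N (down k g)).carrier :=
  tensLift (tens N ∘ₗ LieMod.toLin f)

variable {k g} in
@[simp]
theorem tensMap_tens {M N : LieMod k (LieQuot k g)} (f : M ⟶ N) (n : M.carrier) (x : g) :
    tensMap f (tens M n x) = tens N (LieMod.toLin f n) x := rfl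

variable {k g} in
-- Every vector space is flat. This is what makes `lext` left exact.
theorem tensMap_injective {M N : LieMod k (LieQuot k g)} (f : M ⟶ N)
    (hf : Function.Injective (LieMod.toLin f)) : Function.Injective (tensMap f) := by
  have e : tensMap f = (LieMod.toLin f).rTensor (down k g).carrier :=
    TensorProduct.ext' fun _ _ => rfl
  rw [e]
  exact Module.Flat.rTensor_preserves_injective_linearMap _ hf

variable {k g} in
theorem tensMap_act {M N : LieMod k (LieQuot k g)} (f : M ⟶ N)
    (t : (tensorMod M (down k g)).carrier) (y : g) :
    tensMap f ((tensorMod M (down k g)).act t (toLie k g y)) =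
      (tensorMod N (down k g)).act (tensMap f t) (toLie k g y) := by
  have hf : ∀ m a, LieMod.toLin f (M.act m a) = N.act (LieMod.toLin f m) a := f.2
  have e : tensMap f ∘ₗ (tensorMod M (down k g)).act.flip (toLie k g y) =
      (tensorMod N (down k g)).act.flip (toLie k g y) ∘ₗ tensMap f :=
    tens_ext fun n x => by simp [tens_act, hf]
  exact LinearMap.congr_fun e t

/-- The functor `lext`. -/
def lextFunctor : LieMod k (LieQuot k g) ⥤ LeibMod k g where
  obj N := lext N
  map f := LeibMod.ofLin ((tensMap f).prodMap (LieMod.toLin f))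
    (fun p y => Prod.ext (tensMap_act f p.1 y) (f.2 p.2 _))
    (fun _ p => Prod.ext rfl ((map_neg f.1 _).trans (congrArg Neg.neg (f.2 p.2 _))))
  map_id N := by
    ext ⟨t, n⟩
    have e : tensMap (𝟙 N) = LinearMap.id := tens_ext fun _ _ => rfl
    exact Prod.ext (LinearMap.congr_fun e t) rfl
  map_comp f f' := by
    ext ⟨t, n⟩
    have e : tensMap (f ≫ f') = tensMap f' ∘ₗ tensMap f := tens_ext fun _ _ => rfl
    exact Prod.ext (LinearMap.congr_fun e t) rfl

instance : (lextFunctor k g).Additive where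
  map_add {M N f f'} := by
    ext ⟨t, n⟩
    have e : tensMap (f + f') = tensMap f + tensMap f' := tens_ext fun n x =>
      congrArg (· x) (map_add (tens N) (LieMod.toLin f n) (LieMod.toLin f' n))
    exact Prod.ext (LinearMap.congr_fun e t) rfl

variable {k g} in
/-- The morphism `lext(N) → M` attached to a right equivariant map `f` from `N` to `M`:
it maps `[0, n]` to `f n` and `[n ⊗ z, 0]` to `z (f n) + (f n) z`. -/
def lextDesc {N : LieMod k (LieQuot k g)} {M : LeibMod k g} (f : N.carrier →ₗ[k] M.carrier)
    (hf : ∀ n y, f (N.act n (toLie k g y)) = M.ract (f n) y) : lext N ⟶ M :=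
  LeibMod.ofLin ((tensLift ((M.lact.flip + M.ract) ∘ₗ f)).coprod f)
    (fun p y => by
      -- Right equivariance on tensors: after expanding by LML and MLL, the terms (xy)(f n) and ((f
      -- n)y)x cancel.
      have e : tensLift ((M.lact.flip + M.ract) ∘ₗ f) ∘ₗ
          (tensorMod N (down k g)).act.flip (toLie k g y) =
          M.ract.flip y ∘ₗ tensLift ((M.lact.flip + M.ract) ∘ₗ f) := tens_ext fun n x => by
        simp only [LinearMap.comp_apply, LinearMap.flip_apply, tens_act, map_add, tensLift_tens,
          LinearMap.add_apply, hf, M.lml, M.mll]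
        abel
      refine (congrArg₂ (· + ·) (LinearMap.congr_fun e p.1) (hf p.2 y)).trans ?_
      exact (LinearMap.map_add₂ M.ract _ _ y).symm)
    (by
      rintro z ⟨t, n⟩
      -- Elements xm + mx are killed by the left action: z(xm) = (zx)m - (zm)x by LLM and z(mx) =
      -- (zm)x - (zx)m by LML. This matches z[t, 0] = 0 in `lext N`.
      have e : M.lact z ∘ₗ tensLift ((M.lact.flip + M.ract) ∘ₗ f) = 0 := tens_ext fun n x => by
        simp only [LinearMap.comp_apply, LinearMap.flip_apply, map_add, tensLift_tens,
          LinearMap.add_apply, M.lml, M.llm, LinearMap.zero_apply]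
        abel
      change (M.lact z (f n) + M.ract (f n) z) + f (- N.act n (toLie k g z)) =
        M.lact z (tensLift ((M.lact.flip + M.ract) ∘ₗ f) t + f n)
      have e' : M.lact z (tensLift ((M.lact.flip + M.ract) ∘ₗ f) t) = 0 := LinearMap.congr_fun e t
      rw [map_neg, hf, map_add, e']
      abel)

variable {k g} in
theorem lextDesc_inr {N : LieMod k (LieQuot k g)} {M : LeibMod k g}
    (f : N.carrier →ₗ[k] M.carrier)
    (hf : ∀ n y, f (N.act n (toLie k g y)) = M.ract (f n) y) (n : N.carrier) :
    LeibMod.toLin (lextDesc f hf) ((0 : (tensorMod N (down k g)).carrier), n) = f n :=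
  (congrArg (· + f n) (map_zero (tensLift ((M.lact.flip + M.ract) ∘ₗ f)))).trans (zero_add _)

variable {k g} in
/-- The restriction to `N` of a morphism `lext(N) → M`. -/
def lextRestrict {N : LieMod k (LieQuot k g)} {M : LeibMod k g} (φ : lext N ⟶ M) :
    N ⟶ (rightFunctor k g).obj M :=
  LieMod.ofLin (LeibMod.toLin φ ∘ₗ LinearMap.inr k (tensorMod N (down k g)).carrier N.carrier)
    fun n a => by
      obtain ⟨x, rfl⟩ := toLie_surjective k g a
      refine Eq.trans ?_ (φ.2.1 (0, n) x)
      change φ.1 _ = φ.1 ((tensorMod N (down k g)).act 0 (toLie k g x), N.act n (toLie k g x))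
      rw [map_zero]
      rfl

variable {k g} in
-- In `lext N` one has [n ⊗ z, 0] = z[0, n] + [0, n]z, because the N-components cancel. Hence the
-- copy of N generates `lext N`, and the formula used in `lextDesc` is forced.
theorem lext_hom_tens {N : LieMod k (LieQuot k g)} {M : LeibMod k g} (φ : lext N ⟶ M)
    (n : N.carrier) (z : g) :
    LeibMod.toLin φ (tens N n z, (0 : N.carrier)) =
      M.lact z (LeibMod.toLin φ ((0 : (tensorMod N (down k g)).carrier), n)) +
        M.ract (LeibMod.toLin φ ((0 : (tensorMod N (down k g)).carrier), n)) z := by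
  refine Eq.trans ?_ (congrArg₂ (· + ·) (φ.2.2 z (0, n)) (φ.2.1 (0, n) z))
  refine Eq.trans ?_ (map_add φ.1 _ _)
  refine congrArg φ.1 (Prod.ext ?_ ?_)
  · change tens N n z = tens N n z + (tensorMod N (down k g)).act 0 (toLie k g z)
    simp
  · exact (neg_add_cancel (N.act n (toLie k g z))).symm

variable {k g} in
theorem lext_hom_ext {N : LieMod k (LieQuot k g)} {M : LeibMod k g} {φ ψ : lext N ⟶ M}
    (H : ∀ n : N.carrier, LeibMod.toLin φ ((0 : (tensorMod N (down k g)).carrier), n) =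
      LeibMod.toLin ψ ((0 : (tensorMod N (down k g)).carrier), n)) : φ = ψ := by
  have e : LeibMod.toLin φ ∘ₗ LinearMap.inl k (tensorMod N (down k g)).carrier N.carrier =
      LeibMod.toLin ψ ∘ₗ LinearMap.inl k (tensorMod N (down k g)).carrier N.carrier :=
    tens_ext fun n z =>
      (lext_hom_tens φ n z).trans (Eq.trans (by rw [H]) (lext_hom_tens ψ n z).symm)
  exact Subtype.ext (LinearMap.prod_ext e (LinearMap.ext H))

variable {k g} in
theorem toLin_act_toLie {N : LieMod k (LieQuot k g)} {M : LeibMod k g}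
    (f : N ⟶ (rightFunctor k g).obj M) (n : N.carrier) (y : g) :
    (show N.carrier →ₗ[k] M.carrier from LieMod.toLin f) (N.act n (toLie k g y)) =
      M.ract ((show N.carrier →ₗ[k] M.carrier from LieMod.toLin f) n) y :=
  f.2 n _

variable {k g} in
/-- Morphisms `lext(N) → M` correspond to morphisms from `N` to the right module of `M`. -/
def lextHomEquiv (N : LieMod k (LieQuot k g)) (M : LeibMod k g) :
    (lext N ⟶ M) ≃ (N ⟶ (rightFunctor k g).obj M) where
  toFun φ := lextRestrict φ
  invFun f := lextDesc (M := M) (LieMod.toLin f) (toLin_act_toLie f)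
  left_inv φ := lext_hom_ext fun n =>
    lextDesc_inr (M := M) (LieMod.toLin (lextRestrict φ)) (toLin_act_toLie (lextRestrict φ)) n
  right_inv f := LieMod.hom_ext fun n =>
    lextDesc_inr (M := M) (LieMod.toLin f) (toLin_act_toLie f) n

/-- The functor `lext` is left adjoint to the functor that forgets the left action. -/
def lextAdjunction : lextFunctor k g ⊣ rightFunctor k g :=
  Adjunction.mkOfHomEquiv
    { homEquiv := lextHomEquiv
      homEquiv_naturality_left_symm := fun {X' X Y} f f' => by
        refine (lextHomEquiv X' Y).symm_apply_eq.2 (LieMod.hom_ext fun n => ?_)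
        refine (lextDesc_inr (M := Y) (LieMod.toLin f') (toLin_act_toLie f')
          (LieMod.toLin f n)).symm.trans ?_
        exact congrArg (lextDesc (M := Y) (LieMod.toLin f') (toLin_act_toLie f')).1
          (Prod.ext (map_zero (tensMap f)).symm rfl)
      homEquiv_naturality_right := fun _ _ => rfl }

/-! ### The functor `rext` -/

/-- The functor `rext`. -/
def rextFunctor : LieMod k (LieQuot k g) ⥤ LeibMod k g where
  obj N := rext N
  map {M N} f := LeibMod.ofLin
    ((LieMod.toLin f).prodMap (LinearMap.compRight k (LieMod.toLin f) (M := g)))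
    (by
      rintro ⟨m, p⟩ y
      refine Prod.ext (f.2 m _) (LinearMap.ext fun x => ?_)
      exact (map_sub f.1 _ _).trans (congrArg (· - _) (f.2 _ _)))
    (by
      rintro y ⟨m, p⟩
      refine Prod.ext rfl (LinearMap.ext fun x => ?_)
      exact (map_neg f.1 _).trans
        (congrArg Neg.neg ((map_sub f.1 _ _).trans (congrArg (· - _) (f.2 _ _)))))

instance : (rextFunctor k g).Additive where

variable {k g} in
/-- The morphism `M → rext(N)` attached to a right equivariant map `f` from `M` to `N`:
it maps `m` to `[f m, z ↦ f (z m)]`. -/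
def rextLift {N : LieMod k (LieQuot k g)} {M : LeibMod k g} (f : M.carrier →ₗ[k] N.carrier)
    (hf : ∀ m y, f (M.ract m y) = N.act (f m) (toLie k g y)) : M ⟶ rext N :=
  LeibMod.ofLin (LinearMap.prod f (M.lact.flip.compr₂ f))
    -- On the second component, z ↦ f(zm), compatibility with the right action is LML and
    -- compatibility with the left action is LLM.
    (fun m y => by
      refine Prod.ext (hf m y) (LinearMap.ext fun (x : g) => ?_)
      change f (M.lact x (M.ract m y)) =
        N.act (f (M.lact x m)) (toLie k g y) - f (M.lact (x * y) m)
      rw [M.lml, map_sub, hf])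
    (fun y m => by
      refine Prod.ext rfl (LinearMap.ext fun (x : g) => ?_)
      change f (M.lact x (M.lact y m)) =
        - (N.act (f (M.lact x m)) (toLie k g y) - f (M.lact (x * y) m))
      rw [M.llm, map_sub, hf, neg_sub])

variable {k g} in
/-- The first component of a morphism `M → rext(N)`. -/
def rextFst {N : LieMod k (LieQuot k g)} {M : LeibMod k g} (φ : M ⟶ rext N) :
    (rightFunctor k g).obj M ⟶ N :=
  LieMod.ofLin (LinearMap.fst k N.carrier (homMod (down k g) N).carrier ∘ₗ LeibMod.toLin φ)
    fun m a => by
      obtain ⟨x, rfl⟩ := toLie_surjective k g a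
      exact congrArg Prod.fst (φ.2.1 m x)

variable {k g} in
-- The left action of z on [n, p] has first component p(z), so equivariance recovers the second
-- component of a morphism from the first.
theorem rext_hom_snd {N : LieMod k (LieQuot k g)} {M : LeibMod k g} (φ : M ⟶ rext N)
    (m : M.carrier) (z : g) :
    evalHom N (φ.1 m).2 z = (φ.1 (M.lact z m)).1 :=
  (congrArg Prod.fst (φ.2.2 z m)).symm

variable {k g} in
theorem rext_hom_ext {N : LieMod k (LieQuot k g)} {M : LeibMod k g} {φ ψ : M ⟶ rext N}
    (H : ∀ m : M.carrier, (φ.1 m).1 = (ψ.1 m).1) : φ = ψ := by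
  refine Subtype.ext (LinearMap.ext fun m => Prod.ext (H m) (LinearMap.ext fun z => ?_))
  refine (rext_hom_snd φ m z).trans (Eq.trans ?_ (rext_hom_snd ψ m z).symm)
  rw [H]

variable {k g} in
/-- Morphisms `M → rext(N)` correspond to morphisms from the right module of `M` to `N`. -/
def rextHomEquiv (M : LeibMod k g) (N : LieMod k (LieQuot k g)) :
    ((rightFunctor k g).obj M ⟶ N) ≃ (M ⟶ rext N) where
  toFun f := rextLift (M := M) (LieMod.toLin f) fun m y => f.2 m (toLie k g y)
  invFun φ := rextFst φ
  left_inv _ := rfl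
  right_inv _ := rext_hom_ext fun _ => rfl

/-- The functor `rext` is right adjoint to the functor that forgets the left action. -/
def rextAdjunction : rightFunctor k g ⊣ rextFunctor k g :=
  Adjunction.mkOfHomEquiv
    { homEquiv := rextHomEquiv
      homEquiv_naturality_left_symm := fun _ _ => rfl
      homEquiv_naturality_right := fun _ _ => rext_hom_ext fun _ => rfl }

/-! ### Exactness -/

/-- As a left adjoint `rightFunctor` preserves epimorphisms, and as a right adjoint it preserves
monomorphisms. Consequently its left adjoint preserves projectives and its right adjoint preserves
injectives. -/
instance : (rightFunctor k g).PreservesEpimorphisms :=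
  (rightFunctor k g).preservesEpimorphisms_of_adjunction (rextAdjunction k g)

instance : (rightFunctor k g).PreservesMonomorphisms :=
  (rightFunctor k g).preservesMonomorphisms_of_adjunction (lextAdjunction k g)

instance : (lextFunctor k g).PreservesProjectiveObjects :=
  Functor.preservesProjectiveObjects_of_adjunction_of_preservesEpimorphisms (lextAdjunction k g)

instance : (rextFunctor k g).PreservesInjectiveObjects :=
  Functor.preservesInjectiveObjects_of_adjunction_of_preservesMonomorphisms (rextAdjunction k g)

instance : PreservesFiniteColimits (lextFunctor k g) :=
  have := (lextAdjunction k g).leftAdjoint_preservesColimits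
  inferInstance

instance : PreservesFiniteLimits (rextFunctor k g) :=
  have := (rextAdjunction k g).rightAdjoint_preservesLimits
  inferInstance

/-- A left adjoint is right exact, so only preservation of monomorphisms remains, and it follows
from flatness of g over k. -/
instance : PreservesFiniteLimits (lextFunctor k g) := by
  refine ((lextFunctor k g).preservesFiniteLimits_iff_forall_exact_map_and_mono).2 fun S hS =>
    ⟨(((lextFunctor k g).preservesFiniteColimits_iff_forall_exact_map_and_epi).1
      inferInstance S hS).1, LeibMod.mono_of_injective _ ?_⟩
  have hf := (LieMod.mono_iff_injective S.f).1 hS.mono_f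
  exact Function.Injective.prodMap (f := tensMap S.f) (g := LieMod.toLin S.f)
    (tensMap_injective S.f hf) hf

instance : PreservesFiniteColimits (rextFunctor k g) := by
  refine ((rextFunctor k g).preservesFiniteColimits_iff_forall_exact_map_and_epi).2 fun S hS =>
    ⟨(((rextFunctor k g).preservesFiniteLimits_iff_forall_exact_map_and_mono).1
      inferInstance S hS).1, LeibMod.epi_of_surjective _ ?_⟩
  have hg := (LieMod.epi_iff_surjective S.g).1 hS.epi_g
  refine hg.prodMap (g := (LieMod.toLin S.g).compRight k (M := g)) fun p => ?_
  -- A k-linear section of the surjection, in general not equivariant. It suffices, since only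
  -- surjectivity of postcomposition on Hom_k(g, -) is needed.
  obtain ⟨s, hs⟩ := (LieMod.toLin S.g).exists_rightInverse_of_surjective
    (LinearMap.range_eq_top.2 hg)
  exact ⟨s ∘ₗ (p : g →ₗ[k] S.X₃.carrier), LinearMap.ext fun x => LinearMap.congr_fun hs _⟩

/-! ### The canonical transformations -/

/-- The canonical surjections `lext(N) → N^s`, as a natural transformation. -/
def lextProjNat : lextFunctor k g ⟶ symFunctor k g where
  app N := lextProj N
  naturality _ _ _ := rfl

/-- The canonical inclusions `N^a → rext(N)`, as a natural transformation. -/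
def rextInclNat : asymFunctor k g ⟶ rextFunctor k g where
  app N := rextIncl N
  naturality _ _ _ := rext_hom_ext fun _ => rfl

variable {k g} in
-- This is the adjunction for `lext` with M = Y^s, whose right module is Y: the inverse restricts a
-- morphism to the copy of X. On tensors the morphism must vanish, since zm + mz = 0 in a symmetric
-- module.
theorem bijective_lextProj_comp (X Y : LieMod k (LieQuot k g)) :
    Function.Bijective fun f : X ⟶ Y => lextProj X ≫ (symFunctor k g).map f := by
  refine ⟨fun f f' H => LieMod.hom_ext fun n =>
    congrArg (fun φ => LeibMod.toLin φ ((0 : (tensorMod X (down k g)).carrier), n)) H, fun φ => ?_⟩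
  refine ⟨LieMod.ofLin (show X.carrier →ₗ[k] Y.carrier from (lextRestrict φ).1) fun n a => ?_, lext_hom_ext fun n => rfl⟩
  obtain ⟨x, rfl⟩ := toLie_surjective k g a
  exact toLin_act_toLie (lextRestrict φ) n x

variable {k g} in
-- This is the adjunction for `rext` with M = X^a, whose right module is X: the inverse takes the
-- first component. The second component must vanish, since the left action on X^a is zero.
theorem bijective_comp_rextIncl (X Y : LieMod k (LieQuot k g)) :
    Function.Bijective fun f : X ⟶ Y => (asymFunctor k g).map f ≫ rextIncl Y := by
  refine ⟨fun f f' H => LieMod.hom_ext fun n =>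
    congrArg (fun φ : (asymFunctor k g).obj X ⟶ rext Y => (LeibMod.toLin φ n).1) H, fun φ => ?_⟩
  refine ⟨LieMod.ofLin (show X.carrier →ₗ[k] Y.carrier from (rextFst φ).1) fun n a => ?_, rext_hom_ext fun n => rfl⟩
  obtain ⟨x, rfl⟩ := toLie_surjective k g a
  exact (rextFst φ).2 n (toLie k g x)

end

end LeibnizExt

/-! ### The two comparison isomorphisms -/

theorem proposition7p3 {k g : Type u} [Field k] [NonUnitalNonAssocRing g] [Module k g]
    [IsScalarTower k g g] [SMulCommClass k g g] [LeibnizExt.IsLeibniz g]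
    (N₁ N₂ : LeibnizExt.LieMod k (LeibnizExt.LieQuot k g)) (n : ℕ) :
    Function.Bijective
      ((Abelian.Ext.precompOfLinear (Abelian.Ext.mk₀ (LeibnizExt.lextProj N₁)) k
          ((LeibnizExt.symFunctor k g).obj N₂) (zero_add n)) ∘ₗ
        ((LeibnizExt.symFunctor k g).mapExtLinearMap k N₁ N₂ n)) ∧
    Function.Bijective
      ((Abelian.Ext.postcompOfLinear (Abelian.Ext.mk₀ (LeibnizExt.rextIncl N₂)) k
          ((LeibnizExt.asymFunctor k g).obj N₁) (add_zero n)) ∘ₗ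
        ((LeibnizExt.asymFunctor k g).mapExtLinearMap k N₁ N₂ n)) :=
  -- The k-linear composites have the same underlying functions as the additive ones in the general
  -- theorems.
  ⟨Abelian.Ext.bijective_comp_mapExactFunctor_of_projective
      (LeibnizExt.symFunctor k g) (LeibnizExt.lextFunctor k g) (LeibnizExt.lextProjNat k g) N₂
      (fun X => LeibnizExt.bijective_lextProj_comp X N₂) N₁ n,
    Abelian.Ext.bijective_comp_mapExactFunctor_of_injective
      (LeibnizExt.asymFunctor k g) (LeibnizExt.rextFunctor k g) (LeibnizExt.rextInclNat k g) N₁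
      (fun Y => LeibnizExt.bijective_comp_rextIncl N₁ Y) N₂ n⟩
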